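/- Let $E$ be a (real) Banach lattice and let $W\subseteq E$ be relatively weakly compact. Let $\mathrm{sol}(W)=\{y\in E : |y|\le |x| \text{ for some } x\in W\}$ be the solid hull of $W$. Call a sequence $(x_n)$ in $E$ uaw-null (unbounded absolutely weakly convergent to zero) if, for every $u\in E$ with $u\ge 0$, the sequence $(|x_n|\wedge u)_n$ converges weakly to $0$. Then every uaw-null sequence $(x_n)$ contained in $\mathrm{sol}(W)$ converges weakly to $0$ in $E$. -/

import Mathlib

open Filter Topology

section BanachLattice

variable {E : Type*} [NormedAddCommGroup E] [NormedSpace ℝ E]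

/-- Convergence of the family `x` to `a` along the filter `l` in the weak topology `σ(E, E')`. -/
def WeakTendsto {ι : Type*} (x : ι → E) (l : Filter ι) (a : E) : Prop :=
  Tendsto (fun i => toWeakSpace ℝ E (x i)) l (𝓝 (toWeakSpace ℝ E a))

/-- `W` is relatively weakly compact: its closure in the weak topology is weakly compact. -/
def IsRelativelyWeaklyCompact (W : Set E) : Prop :=
  IsCompact (closure (toWeakSpace ℝ E '' W))

/-- Unbounded absolutely weak convergence of `x` to `a` along `l`: for every `u ≥ 0`,
the family `|x i - a| ⊓ u` converges weakly to `0`. -/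
def UawTendsto [Lattice E] {ι : Type*} (x : ι → E) (l : Filter ι) (a : E) : Prop :=
  ∀ u : E, 0 ≤ u → WeakTendsto (fun i => |x i - a| ⊓ u) l 0

end BanachLattice

/-!
Weak convergence is tested on a functional `h`, which is dominated by a positive one:
`|h y| ≤ f |y|`. For `u ≥ 0`, splitting `|y|` into `|y| ⊓ u` and `(|y| - u)⁺` reduces the theorem to
finding, for each `ε > 0`, one `u` with `f (|w| - u)⁺ ≤ ε` on all of `W`; uaw-convergence controls
the other part.

If there is no such `u`, disjointification produces `wₖ ∈ W` and pairwise disjoint `0 ≤ vₖ ≤ |wₖ|`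
with `f vₖ` bounded away from `0`. By Hahn–Banach there are functionals `gₖ`, dominated by the
components of `f` on the bands generated by the `vₖ`, with `gₖ wₖ ≥ f vₖ`. Disjointness makes
`∑ gₖ x` unconditionally convergent for every `x`, so all subsums of `∑ gₖ` are weakly continuous on
the weak closure of `W`. On a compact space this forces the terms to tend to `0` uniformly, whence
`f vₖ ≤ gₖ wₖ → 0`, a contradiction.
-/

section UnconditionalSeries

theorem exists_eventually_update_mem_of_iUnion_eq_univ {α ι : Type*} [TopologicalSpace α]
    [Nonempty α] [BaireSpace (ℕ → α)] [Countable ι] {A : ι → Set (ℕ → α)}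
    (hA : ∀ i, IsClosed (A i)) (hcover : ⋃ i, A i = Set.univ) :
    ∃ i t, ∀ b, ∀ᶠ n in atTop, Function.update t n b ∈ A i := by
  obtain ⟨i, t, ht⟩ := nonempty_interior_of_iUnion_of_closed hA hcover
  refine ⟨i, t, fun b => ?_⟩
  have hlim : Tendsto (fun n => Function.update t n b) atTop (𝓝 t) :=
    tendsto_pi_nhds.2 fun k => tendsto_const_nhds.congr' <|
      (eventually_ne_atTop k).mono fun n hn => (Function.update_of_ne hn.symm b t).symm
  exact hlim (mem_interior_iff_mem_nhds.1 ht)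

theorem continuous_tsum_subtype {ι V : Type*} [NormedAddCommGroup V] [CompleteSpace V] {a : ι → V}
    (ha : Summable fun k => ‖a k‖) :
    Continuous fun t : ι → Bool => ∑' k : {k | t k}, a k := by
  simp only [tsum_subtype]
  refine continuous_tsum (fun k => ?_) ha fun k t => norm_indicator_le_norm_self a k
  simp only [Set.indicator_apply, Set.mem_ofPred_eq]
  exact (continuous_of_discreteTopology (f := fun b : Bool => if b then a k else 0)).comp
    (continuous_apply k)

theorem tsum_update_true_sub_tsum_update_false {ι V : Type*} [DecidableEq ι] [AddCommGroup V]
    [UniformSpace V] [IsUniformAddGroup V] [CompleteSpace V] [T2Space V] {a : ι → V}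
    (ha : Summable a) (t : ι → Bool) (i : ι) :
    ∑' k : {k | Function.update t i true k}, a k - ∑' k : {k | Function.update t i false k}, a k =
      a i := by
  rw [tsum_subtype, tsum_subtype, ← (ha.indicator _).tsum_sub (ha.indicator _), tsum_eq_single i]
  · simp
  · intro k hk
    simp [Set.indicator_apply, Function.update_of_ne hk]

/-- A subset of `ℕ` is a point of the Cantor space, and by the Baire category theorem the subsums
along all subsets in some open set stay close to one function; there, switching a large index `n`
in or out of a subset changes the subsum by exactly `u n`. -/
theorem tendstoUniformly_zero_of_continuous_tsum_of_separableSpace {X : Type*} [TopologicalSpace X]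
    [CompactSpace X] [TopologicalSpace.SeparableSpace C(X, ℝ)] {u : ℕ → X → ℝ}
    (hu : ∀ x, Summable (u · x)) (hcont : ∀ S : Set ℕ, Continuous fun x => ∑' k : S, u k x) :
    TendstoUniformly u 0 atTop := by
  rw [Metric.tendstoUniformly_iff]
  intro ε hε
  let F : (ℕ → Bool) → C(X, ℝ) := fun t => ⟨fun x => ∑' k : {k | t k}, u k x, hcont _⟩
  let f : ℕ → C(X, ℝ) := TopologicalSpace.denseSeq C(X, ℝ)
  have isClosed_near (i : ℕ) : IsClosed {t | ∀ x, |F t x - f i x| ≤ ε / 3} := by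
    simp only [Set.ofPred_forall]
    exact isClosed_iInter fun x => isClosed_le
      ((continuous_tsum_subtype (hu x).norm).sub continuous_const).abs continuous_const
  have iUnion_near : ⋃ i, {t | ∀ x, |F t x - f i x| ≤ ε / 3} = Set.univ := by
    refine Set.eq_univ_of_forall fun t => Set.mem_iUnion.2 ?_
    obtain ⟨i, hi⟩ :=
      (TopologicalSpace.denseRange_denseSeq C(X, ℝ)).exists_dist_lt (F t) (div_pos hε three_pos)
    exact ⟨i, fun x => (ContinuousMap.dist_apply_le_dist x).trans hi.le⟩
  obtain ⟨i, t, ht⟩ := exists_eventually_update_mem_of_iUnion_eq_univ isClosed_near iUnion_near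
  filter_upwards [ht true, ht false] with n htrue hfalse x
  calc dist (0 : ℝ) (u n x)
      = |F (Function.update t n true) x - F (Function.update t n false) x| := by
        rw [dist_zero_left, Real.norm_eq_abs]
        exact congrArg abs (tsum_update_true_sub_tsum_update_false (hu x) t n).symm
    _ ≤ |F (Function.update t n true) x - f i x| + |F (Function.update t n false) x - f i x| := by
        rw [abs_sub_comm (F (Function.update t n false) x)]
        exact abs_sub_le _ _ _
    _ < ε := by linarith [htrue x, hfalse x]

theorem tendstoUniformly_zero_of_continuous_tsum {X : Type*} [TopologicalSpace X] [CompactSpace X]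
    {u : ℕ → X → ℝ} (hu : ∀ x, Summable (u · x))
    (hcont : ∀ S : Set ℕ, Continuous fun x => ∑' k : S, u k x) : TendstoUniformly u 0 atTop := by
  -- All subsums factor through the image of `X` in `ℕ → ℝ`, which is compact and metrizable.
  let T : X → ℕ → ℝ := fun x k => u k x
  have hT : Continuous T := continuous_pi fun k =>
    (hcont {k}).congr fun x => tsum_singleton k (u · x)
  have : CompactSpace (Set.range T) := isCompact_iff_compactSpace.1 (isCompact_range hT)
  have hquot : IsQuotientMap (Set.rangeFactorization T) :=
    .of_surjective_continuous Set.rangeFactorization_surjective hT.rangeFactorization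
  have key : TendstoUniformly (fun k (y : Set.range T) => y.1 k) 0 atTop := by
    refine tendstoUniformly_zero_of_continuous_tsum_of_separableSpace ?_ fun S =>
      hquot.continuous_iff.2 (hcont S)
    rintro ⟨_, x, rfl⟩
    exact hu x
  exact key.comp (Set.rangeFactorization T)

end UnconditionalSeries

section WeakTopology

variable {E : Type*} [NormedAddCommGroup E] [NormedSpace ℝ E]

theorem weakTendsto_iff_forall_apply {ι : Type*} {x : ι → E} {l : Filter ι} {a : E} :
    WeakTendsto x l a ↔ ∀ h : E →L[ℝ] ℝ, Tendsto (fun i => h (x i)) l (𝓝 (h a)) := by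
  have hinj : Function.Injective (topDualPairing ℝ E).flip := fun a b hab =>
    (SeparatingDual.eq_iff_forall_dual_eq (R := ℝ)).2 fun h => LinearMap.congr_fun hab h
  exact WeakBilin.tendsto_iff_forall_eval_tendsto (topDualPairing ℝ E).flip hinj

theorem continuous_apply_toWeakSpace_symm (h : E →L[ℝ] ℝ) :
    Continuous fun y : WeakSpace ℝ E => h ((toWeakSpace ℝ E).symm y) :=
  WeakBilin.eval_continuous (topDualPairing ℝ E).flip h

theorem IsRelativelyWeaklyCompact.exists_norm_le {W : Set E} (hW : IsRelativelyWeaklyCompact W) :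
    ∃ M, ∀ w ∈ W, ‖w‖ ≤ M := by
  obtain ⟨M, hM⟩ := banach_steinhaus
    (g := fun w : W => NormedSpace.inclusionInDoubleDual ℝ E w) fun h => by
      obtain ⟨C, hC⟩ :=
        (hW.image (continuous_apply_toWeakSpace_symm h)).isBounded.exists_norm_le
      exact ⟨C, fun w => hC _ ⟨_, subset_closure (Set.mem_image_of_mem _ w.2), rfl⟩⟩
  exact ⟨M, fun w hw =>
    ((NormedSpace.inclusionInDoubleDualLi ℝ).norm_map w).symm.trans_le (hM ⟨w, hw⟩)⟩

theorem exists_continuousLinearMap_eq_tsum {𝕜 V F ι : Type*} [NontriviallyNormedField 𝕜]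
    [NormedAddCommGroup V] [NormedSpace 𝕜 V] [CompleteSpace V] [NormedAddCommGroup F]
    [NormedSpace 𝕜 F] [Countable ι] {g : ι → V →L[𝕜] F} (hg : ∀ x, Summable (g · x)) :
    ∃ G : V →L[𝕜] F, ∀ x, G x = ∑' i, g i x := by
  have hlim : Tendsto (fun (s : Finset ι) x => (∑ i ∈ s, g i) x) atTop
      (𝓝 fun x => ∑' i, g i x) :=
    tendsto_pi_nhds.2 fun x => by
      simp only [sum_apply]
      exact (hg x).hasSum
  exact ⟨continuousLinearMapOfTendsto (fun s : Finset ι => ∑ i ∈ s, g i) hlim, fun x => rfl⟩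

theorem IsRelativelyWeaklyCompact.tendstoUniformlyOn_zero_of_summable [CompleteSpace E] {W : Set E}
    (hW : IsRelativelyWeaklyCompact W) {g : ℕ → E →L[ℝ] ℝ} (hg : ∀ x, Summable (g · x)) :
    TendstoUniformlyOn (fun k x => g k x) 0 atTop W := by
  have : CompactSpace (closure (toWeakSpace ℝ E '' W)) := isCompact_iff_compactSpace.1 hW
  have key : TendstoUniformly (fun k (y : closure (toWeakSpace ℝ E '' W)) =>
      g k ((toWeakSpace ℝ E).symm y)) 0 atTop := by
    refine tendstoUniformly_zero_of_continuous_tsum (fun y => hg _) fun S => ?_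
    obtain ⟨G, hG⟩ := exists_continuousLinearMap_eq_tsum (g := fun k : S => g k)
      fun x => (hg x).subtype S
    exact ((continuous_apply_toWeakSpace_symm G).comp continuous_subtype_val).congr fun y => hG _
  rw [Metric.tendstoUniformlyOn_iff]
  intro ε hε
  filter_upwards [Metric.tendstoUniformly_iff.1 key ε hε] with k hk w hw
  exact hk ⟨_, subset_closure (Set.mem_image_of_mem _ hw)⟩

end WeakTopology

section HahnBanach

theorem exists_continuousLinearMap_apply_eq_seminorm {E : Type*} [NormedAddCommGroup E]
    [NormedSpace ℝ E] (p : Seminorm ℝ E) {C : ℝ} (hp : ∀ x, p x ≤ C * ‖x‖) (w : E) :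
    ∃ g : E →L[ℝ] ℝ, g w = p w ∧ ∀ x, |g x| ≤ p x := by
  have hwd : ∀ c : ℝ, c • w = 0 → (RingHom.id ℝ) c • p w = 0 := fun c hc => by
    rcases smul_eq_zero.1 hc with rfl | rfl <;> simp
  let onSpan : E →ₗ.[ℝ] ℝ := LinearPMap.mkSpanSingleton' (σ := RingHom.id ℝ) w (p w) hwd
  obtain ⟨g, hgw, hgp⟩ :=
    Module.Dual.exists_extension_of_le_seminorm_real onSpan.domain onSpan.toFun (p := p) <| by
      rintro ⟨x, hx⟩
      obtain ⟨c, rfl⟩ := Submodule.mem_span_singleton.1 hx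
      refine (LinearPMap.mkSpanSingleton'_apply w (p w) hwd c hx).trans_le ?_
      rw [map_smul_eq_mul]
      exact mul_le_mul_of_nonneg_right (le_abs_self c) (apply_nonneg p w)
  refine ⟨g.mkContinuous C fun x => (hgp x).trans (hp x), ?_, hgp⟩
  exact (hgw ⟨w, Submodule.mem_span_singleton_self w⟩).trans
    (LinearPMap.mkSpanSingleton'_apply_self w (p w) hwd _)

theorem exists_add_eq_of_le_add_sublinear {V : Type*} [AddCommGroup V] [Module ℝ V] {p q : V → ℝ}
    (p_smul : ∀ c : ℝ, 0 < c → ∀ x, p (c • x) = c * p x) (p_add : ∀ x y, p (x + y) ≤ p x + p y)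
    (q_smul : ∀ c : ℝ, 0 < c → ∀ x, q (c • x) = c * q x) (q_add : ∀ x y, q (x + y) ≤ q x + q y)
    (h : V →ₗ[ℝ] ℝ) (hpq : ∀ x, h x ≤ p x + q x) :
    ∃ f g : V →ₗ[ℝ] ℝ, f + g = h ∧ (∀ x, f x ≤ p x) ∧ ∀ x, g x ≤ q x := by
  have p_zero : p 0 = 0 := by linarith [smul_zero (M := ℝ) (A := V) 2 ▸ p_smul 2 two_pos 0]
  have q_zero : q 0 = 0 := by linarith [smul_zero (M := ℝ) (A := V) 2 ▸ q_smul 2 two_pos 0]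
  let diagonal : Submodule ℝ (V × V) := LinearMap.eqLocus (.fst ℝ V V) (.snd ℝ V V)
  obtain ⟨F, hF, hFpq⟩ := exists_extension_of_le_sublinear
    ⟨diagonal, (h ∘ₗ LinearMap.fst ℝ V V).domRestrict diagonal⟩ (fun y => p y.1 + q y.2)
    (fun c hc y => by simp only [Prod.smul_fst, Prod.smul_snd, p_smul c hc, q_smul c hc, mul_add])
    (fun y z => by
      simp only [Prod.fst_add, Prod.snd_add]
      linarith [p_add y.1 z.1, q_add y.2 z.2])
    (by
      rintro ⟨⟨x, y⟩, hxy⟩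
      obtain rfl : x = y := hxy
      exact hpq x)
  refine ⟨F ∘ₗ .inl ℝ V V, F ∘ₗ .inr ℝ V V, ?_, fun x => ?_, fun x => ?_⟩
  · ext x
    calc F (x, 0) + F (0, x) = F (x, x) := by simp [← map_add]
      _ = h x := hF ⟨(x, x), rfl⟩
  · simpa [q_zero] using hFpq (x, 0)
  · simpa [p_zero] using hFpq (0, x)

end HahnBanach

section LatticeGroup

theorem inf_eq_zero_of_le {E : Type*} [AddCommGroup E] [Lattice E] {a b c d : E} (ha : 0 ≤ a)
    (hb : 0 ≤ b) (hac : a ≤ c) (hbd : b ≤ d) (hcd : c ⊓ d = 0) : a ⊓ b = 0 :=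
  le_antisymm ((inf_le_inf hac hbd).trans_eq hcd) (le_inf ha hb)

theorem abs_apply_le_apply_abs {E F β : Type*} [AddCommGroup E] [Lattice E] [AddCommGroup β]
    [Lattice β] [FunLike F E β] [AddMonoidHomClass F E β] {f : F} (hf : Monotone f) (x : E) :
    |f x| ≤ f |x| :=
  sup_le (hf (le_abs_self x)) ((map_neg f x).symm.trans_le (hf (neg_le_abs x)))

variable {E : Type*} [AddCommGroup E] [Lattice E] [IsOrderedAddMonoid E]

theorem posPart_add_le (a b : E) : (a + b)⁺ ≤ a⁺ + b⁺ :=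
  sup_le (add_le_add (le_posPart a) (le_posPart b))
    (add_nonneg (posPart_nonneg a) (posPart_nonneg b))

theorem posPart_le_posPart_sub_add (a : E) {b : E} (hb : 0 ≤ b) : a⁺ ≤ (a - b)⁺ + b := by
  simpa only [sub_add_cancel, posPart_of_nonneg hb] using posPart_add_le (a - b) b

theorem inf_add_posPart_sub (a b : E) : a ⊓ b + (a - b)⁺ = a := by
  rw [inf_eq_sub_posPart_sub, sub_add_cancel]

theorem add_inf_le_inf_add_inf {a b c : E} (ha : 0 ≤ a) (hb : 0 ≤ b) (hc : 0 ≤ c) :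
    (a + b) ⊓ c ≤ a ⊓ c + b ⊓ c := by
  rw [add_inf, inf_add, inf_add]
  exact le_inf (le_inf inf_le_left (inf_le_right.trans (le_add_of_nonneg_right hb)))
    (le_inf (inf_le_right.trans (le_add_of_nonneg_left ha))
      (inf_le_right.trans (le_add_of_nonneg_left hc)))

theorem sum_inf_eq_zero {ι : Type*} {s : Finset ι} {a : ι → E} {b : E} (ha : ∀ i ∈ s, 0 ≤ a i)
    (hb : 0 ≤ b) (hab : ∀ i ∈ s, a i ⊓ b = 0) : (∑ i ∈ s, a i) ⊓ b = 0 := by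
  classical
  induction s using Finset.induction_on with
  | empty => simpa using hb
  | insert k s hk ih =>
    simp only [Finset.forall_mem_insert] at ha hab
    have hsum : 0 ≤ ∑ i ∈ s, a i := Finset.sum_nonneg ha.2
    rw [Finset.sum_insert hk]
    refine le_antisymm ?_ (le_inf (add_nonneg ha.1 hsum) hb)
    simpa only [hab.1, ih ha.2 hab.2, add_zero] using add_inf_le_inf_add_inf ha.1 hsum hb

theorem sum_le_of_pairwise_inf_eq_zero {ι : Type*} {s : Finset ι} {a : ι → E} {b : E}
    (ha : ∀ i ∈ s, 0 ≤ a i) (hb : 0 ≤ b) (hab : ∀ i ∈ s, a i ≤ b)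
    (hdisj : (s : Set ι).Pairwise fun i j => a i ⊓ a j = 0) : ∑ i ∈ s, a i ≤ b := by
  classical
  induction s using Finset.induction_on with
  | empty => simpa using hb
  | insert k s hk ih =>
    simp only [Finset.forall_mem_insert] at ha hab
    rw [Finset.coe_insert, Set.pairwise_insert_of_notMem hk] at hdisj
    have hinf : (∑ i ∈ s, a i) ⊓ a k = 0 :=
      sum_inf_eq_zero ha.2 ha.1 fun i hi => (hdisj.2 i hi).2
    rw [Finset.sum_insert hk, ← inf_add_sup, inf_comm, hinf, zero_add]
    exact sup_le hab.1 (ih ha.2 hab.2 hdisj.1)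

theorem abs_sub_sub_le {a b c : E} (u : E) (hac : |a| ≤ c) : |a - b| - (u + |b|) ≤ c - u :=
  calc |a - b| - (u + |b|) ≤ |a| + |b| - (u + |b|) := by
        simpa only [sub_eq_add_neg, abs_neg] using sub_le_sub_right (abs_add_le a (-b)) _
    _ = |a| - u := add_sub_add_right_eq_sub _ _ _
    _ ≤ c - u := sub_le_sub_right hac u

end LatticeGroup

section OrderedModule

variable {𝕜 E : Type*} [Field 𝕜] [LinearOrder 𝕜] [IsStrictOrderedRing 𝕜] [AddCommGroup E]
  [Lattice E] [Module 𝕜 E] [IsOrderedModule 𝕜 E]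

theorem smul_inf_of_nonneg {c : 𝕜} (hc : 0 ≤ c) (a b : E) : c • (a ⊓ b) = c • a ⊓ c • b := by
  rcases hc.eq_or_lt with rfl | hc
  · simp
  · exact (OrderIso.smulRight hc).map_inf a b

theorem smul_sup_of_nonneg {c : 𝕜} (hc : 0 ≤ c) (a b : E) : c • (a ⊔ b) = c • a ⊔ c • b := by
  rcases hc.eq_or_lt with rfl | hc
  · simp
  · exact (OrderIso.smulRight hc).map_sup a b

theorem posPart_smul_of_nonneg {c : 𝕜} (hc : 0 ≤ c) (a : E) : (c • a)⁺ = c • a⁺ := by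
  rw [posPart_def, posPart_def, smul_sup_of_nonneg hc, smul_zero]

theorem abs_smul_eq (c : 𝕜) (a : E) : |c • a| = |c| • |a| := by
  have abs_smul_of_nonneg {c : 𝕜} (hc : 0 ≤ c) : |c • a| = c • |a| := by
    simp only [abs, smul_sup_of_nonneg hc, smul_neg]
  rcases abs_cases c with ⟨hc, hc'⟩ | ⟨hc, hc'⟩
  · rw [hc, abs_smul_of_nonneg hc']
  · rw [hc, ← abs_smul_of_nonneg (neg_nonneg.2 hc'.le), neg_smul, abs_neg]

variable [IsOrderedAddMonoid E]

theorem smul_inf_eq_zero {c : 𝕜} (hc : 0 ≤ c) {a b : E} (ha : 0 ≤ a) (hb : 0 ≤ b)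
    (hab : a ⊓ b = 0) : c • a ⊓ b = 0 := by
  refine le_antisymm ?_ (le_inf (smul_nonneg hc ha) hb)
  calc c • a ⊓ b ≤ (c + 1) • a ⊓ (c + 1) • b := by
        simp only [add_smul, one_smul]
        exact inf_le_inf (le_add_of_nonneg_right ha) (le_add_of_nonneg_left (smul_nonneg hc hb))
    _ = 0 := by rw [← smul_inf_of_nonneg (by positivity), hab, smul_zero]

end OrderedModule

section BandSeminorm

variable {E : Type*} [AddCommGroup E] [Lattice E] [Module ℝ E]

theorem bddAbove_range_apply_abs_inf_smul {f : E →ₗ[ℝ] ℝ} (hf : Monotone f) (v x : E) :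
    BddAbove (Set.range fun t : NNReal => f (|x| ⊓ (t : ℝ) • v)) :=
  ⟨f |x|, Set.forall_mem_range.2 fun _ => hf inf_le_left⟩

variable [IsOrderedAddMonoid E] [IsOrderedModule ℝ E]

/-- For a positive functional `f` and `v ≥ 0`, the seminorm `x ↦ sup_t f (|x| ⊓ t v)`, the value
at `|x|` of the component of `f` carried by the band that `v` generates. -/
noncomputable def bandSeminorm (f : E →ₗ[ℝ] ℝ) (hf : Monotone f) (v : E) (hv : 0 ≤ v) :
    Seminorm ℝ E :=
  .ofSMulLE (fun x => ⨆ t : NNReal, f (|x| ⊓ (t : ℝ) • v))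
    (by
      have hinf (t : NNReal) : |(0 : E)| ⊓ (t : ℝ) • v = 0 := by
        rw [abs_zero, inf_eq_left.2 (smul_nonneg t.coe_nonneg hv)]
      simp only [hinf, map_zero, ciSup_const])
    (fun x y => ciSup_le fun t => by
      calc f (|x + y| ⊓ (t : ℝ) • v)
          ≤ f (|x| ⊓ (t : ℝ) • v + |y| ⊓ (t : ℝ) • v) :=
            hf ((inf_le_inf_right _ (abs_add_le x y)).trans (add_inf_le_inf_add_inf
              (abs_nonneg x) (abs_nonneg y) (smul_nonneg t.coe_nonneg hv)))
        _ = f (|x| ⊓ (t : ℝ) • v) + f (|y| ⊓ (t : ℝ) • v) := map_add f _ _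
        _ ≤ _ := add_le_add (le_ciSup (bddAbove_range_apply_abs_inf_smul hf v x) t)
            (le_ciSup (bddAbove_range_apply_abs_inf_smul hf v y) t))
    (fun c x => ciSup_le fun t => by
      rcases eq_or_ne c 0 with rfl | hc
      · rw [zero_smul, abs_zero, inf_eq_left.2 (smul_nonneg t.coe_nonneg hv), map_zero,
          norm_zero, zero_mul]
      · calc f (|c • x| ⊓ (t : ℝ) • v)
            = |c| * f (|x| ⊓ (|c|⁻¹ * t) • v) := by
              rw [abs_smul_eq, ← smul_eq_mul, ← map_smul, smul_inf_of_nonneg (abs_nonneg c),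
                smul_smul, mul_inv_cancel_left₀ (abs_ne_zero.2 hc)]
          _ ≤ _ := mul_le_mul_of_nonneg_left
              (le_ciSup (bddAbove_range_apply_abs_inf_smul hf v x)
                ⟨|c|⁻¹ * t, by positivity⟩) (abs_nonneg c))

variable {f : E →ₗ[ℝ] ℝ} (hf : Monotone f)

theorem apply_le_bandSeminorm {v w : E} (hv : 0 ≤ v) (hvw : v ≤ |w|) :
    f v ≤ bandSeminorm f hf v hv w :=
  le_ciSup_of_le (bddAbove_range_apply_abs_inf_smul hf v w) 1 <| by
    rw [NNReal.coe_one, one_smul, inf_eq_right.2 hvw]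

theorem sum_bandSeminorm_le {ι : Type*} {v : ι → E} (hv : ∀ k, 0 ≤ v k)
    (hdisj : Pairwise fun i j => v i ⊓ v j = 0) (s : Finset ι) (x : E) :
    ∑ k ∈ s, bandSeminorm f hf (v k) (hv k) x ≤ f |x| := by
  have hlim : Tendsto (fun t : NNReal => ∑ k ∈ s, f (|x| ⊓ (t : ℝ) • v k)) atTop
      (𝓝 (∑ k ∈ s, bandSeminorm f hf (v k) (hv k) x)) :=
    tendsto_finsetSum _ fun k _ => tendsto_atTop_ciSup
      (fun _ _ ht => hf (inf_le_inf_left _ (smul_le_smul_of_nonneg_right ht (hv k))))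
      (bddAbove_range_apply_abs_inf_smul hf (v k) x)
  refine le_of_tendsto' hlim fun t => ?_
  have inf_nonneg (k : ι) : 0 ≤ |x| ⊓ (t : ℝ) • v k :=
    le_inf (abs_nonneg x) (smul_nonneg t.coe_nonneg (hv k))
  rw [← map_sum]
  refine hf (sum_le_of_pairwise_inf_eq_zero (fun k _ => inf_nonneg k) (abs_nonneg x)
    (fun k _ => inf_le_left) fun i _ j _ hij => ?_)
  refine inf_eq_zero_of_le (inf_nonneg i) (inf_nonneg j) inf_le_right inf_le_right ?_
  rw [← smul_inf_of_nonneg t.coe_nonneg, hdisj hij, smul_zero]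

theorem bandSeminorm_le {v : E} (hv : 0 ≤ v) (x : E) : bandSeminorm f hf v hv x ≤ f |x| :=
  ciSup_le fun _ => hf inf_le_left

end BandSeminorm

section Disjointification

variable {E : Type*} [AddCommGroup E] [Lattice E] [Module ℝ E]

/-- A pairwise disjoint sequence below a sequence `a ≥ 0`, for `z` dominating every `2⁻ⁿ a n`;
see Aliprantis and Burkinshaw, *Positive Operators*, Lemma 4.35. -/
noncomputable def disjointification (a : ℕ → E) (z : E) (n : ℕ) : E :=
  (a n - (4 : ℝ) ^ n • ∑ i ∈ Finset.range n, a i - (1 / 2 : ℝ) ^ n • z)⁺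

variable {a : ℕ → E} {z : E}

theorem disjointification_nonneg (n : ℕ) : 0 ≤ disjointification a z n :=
  posPart_nonneg _

variable [IsOrderedAddMonoid E] [IsOrderedModule ℝ E]

theorem disjointification_le_posPart_sub (ha : ∀ n, 0 ≤ a n) (n : ℕ) :
    disjointification a z n ≤ (a n - (1 / 2 : ℝ) ^ n • z)⁺ :=
  posPart_mono <| sub_le_sub_right (sub_le_self _ <|
    smul_nonneg (by positivity) (Finset.sum_nonneg fun i _ => ha i)) _

theorem disjointification_le (ha : ∀ n, 0 ≤ a n) (hz : 0 ≤ z) (n : ℕ) :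
    disjointification a z n ≤ a n :=
  (disjointification_le_posPart_sub ha n).trans <|
    sup_le (sub_le_self _ (smul_nonneg (by positivity) hz)) (ha n)

theorem disjointification_le_posPart_sub_smul (ha : ∀ n, 0 ≤ a n) (hz : 0 ≤ z) {m n : ℕ}
    (hmn : m < n) : disjointification a z n ≤ (a n - (4 : ℝ) ^ n • a m)⁺ :=
  posPart_mono <| (sub_le_self _ (smul_nonneg (by positivity) hz)).trans <| sub_le_sub_left
    (smul_le_smul_of_nonneg_left
      (Finset.single_le_sum (fun i _ => ha i) (Finset.mem_range.2 hmn)) (by positivity)) _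

theorem posPart_sub_smul_le_disjointification_add (hz : 0 ≤ z) (n : ℕ) :
    (a n - (4 : ℝ) ^ n • ∑ i ∈ Finset.range n, a i)⁺ ≤
      disjointification a z n + (1 / 2 : ℝ) ^ n • z :=
  posPart_le_posPart_sub_add _ (smul_nonneg (by positivity) hz)

theorem disjointification_inf_eq_zero_of_lt (ha : ∀ n, 0 ≤ a n) (hz : 0 ≤ z)
    (haz : ∀ n, (1 / 2 : ℝ) ^ n • a n ≤ z) {m n : ℕ} (hmn : m < n) :
    disjointification a z m ⊓ disjointification a z n = 0 := by
  let b := a m - (1 / 2 : ℝ) ^ (m + n) • a n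
  have le_posPart : disjointification a z m ≤ b⁺ := by
    refine (disjointification_le_posPart_sub ha m).trans (posPart_mono (sub_le_sub_left ?_ _))
    rw [pow_add, mul_smul]
    exact smul_le_smul_of_nonneg_left (haz n) (by positivity)
  have le_negPart : disjointification a z n ≤ (2 : ℝ) ^ (m + n) • b⁻ := by
    have hpow : (2 : ℝ) ^ (m + n) ≤ 4 ^ n :=
      calc (2 : ℝ) ^ (m + n) ≤ 2 ^ (2 * n) := pow_le_pow_right₀ one_le_two (by lia)
        _ = 4 ^ n := by rw [pow_mul]; norm_num
    calc disjointification a z n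
        ≤ (a n - (4 : ℝ) ^ n • a m)⁺ := disjointification_le_posPart_sub_smul ha hz hmn
      _ ≤ (a n - (2 : ℝ) ^ (m + n) • a m)⁺ :=
        posPart_mono (sub_le_sub_left (smul_le_smul_of_nonneg_right hpow (ha m)) _)
      _ = ((2 : ℝ) ^ (m + n) • -b)⁺ := by
        rw [neg_sub, smul_sub, smul_smul, ← mul_pow]
        norm_num
      _ = (2 : ℝ) ^ (m + n) • b⁻ := by
        rw [posPart_smul_of_nonneg (by positivity), posPart_neg]
  refine inf_eq_zero_of_le (disjointification_nonneg m) (disjointification_nonneg n) le_posPart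
    le_negPart ?_
  rw [inf_comm]
  refine smul_inf_eq_zero (by positivity) (negPart_nonneg b) (posPart_nonneg b) ?_
  rw [inf_comm, posPart_inf_negPart_eq_zero]

theorem pairwise_disjointification_inf_eq_zero (ha : ∀ n, 0 ≤ a n) (hz : 0 ≤ z)
    (haz : ∀ n, (1 / 2 : ℝ) ^ n • a n ≤ z) :
    Pairwise fun m n => disjointification a z m ⊓ disjointification a z n = 0 := by
  intro m n hmn
  rcases hmn.lt_or_gt with h | h
  · exact disjointification_inf_eq_zero_of_lt ha hz haz h
  · rw [inf_comm]
    exact disjointification_inf_eq_zero_of_lt ha hz haz h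

end Disjointification

theorem exists_seq_forall_sum_range {α M : Type*} [AddCommMonoid M] (φ : α → M)
    {P : ℕ → M → α → Prop} (hP : ∀ k s, ∃ b, P k s b) :
    ∃ a : ℕ → α, ∀ k, P k (∑ i ∈ Finset.range k, φ (a i)) (a k) := by
  choose next hnext using hP
  let S : ℕ → M := fun k => Nat.rec 0 (fun k s => s + φ (next k s)) k
  refine ⟨fun k => next k (S k), fun k => ?_⟩
  have hS : S k = ∑ i ∈ Finset.range k, φ (next i (S i)) := by
    induction k with
    | zero => rfl
    | succ k ih => rw [Finset.sum_range_succ, ← ih]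
  exact hS ▸ hnext k (S k)

section NormedLattice

theorem norm_le_norm_posPart_add_norm_posPart_neg {E : Type*} [NormedAddCommGroup E] [Lattice E]
    [IsOrderedAddMonoid E] (a : E) : ‖a‖ ≤ ‖a⁺‖ + ‖(-a)⁺‖ := by
  simpa only [posPart_sub_negPart, posPart_neg] using norm_sub_le a⁺ a⁻

variable {E : Type*} [NormedAddCommGroup E] [Lattice E] [IsOrderedAddMonoid E] [HasSolidNorm E]

theorem norm_posPart_le (a : E) : ‖a⁺‖ ≤ ‖a‖ :=
  norm_le_norm_of_abs_le_abs <| by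
    rw [abs_of_nonneg (posPart_nonneg a)]
    exact sup_le (le_abs_self a) (abs_nonneg a)

theorem norm_posPart_add_le (a b : E) : ‖(a + b)⁺‖ ≤ ‖a⁺‖ + ‖b⁺‖ := by
  refine (norm_le_norm_of_abs_le_abs ?_).trans (norm_add_le _ _)
  rw [abs_of_nonneg (posPart_nonneg _),
    abs_of_nonneg (add_nonneg (posPart_nonneg a) (posPart_nonneg b))]
  exact posPart_add_le a b

variable [NormedSpace ℝ E]

theorem exists_monotone_continuousLinearMap_eq {f : E →ₗ[ℝ] ℝ} {C : ℝ} (hC : 0 ≤ C)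
    (hf : ∀ x, f x ≤ C * ‖x⁺‖) : ∃ g : E →L[ℝ] ℝ, Monotone g ∧ ∀ x, g x = f x := by
  have hf_norm (x : E) : f x ≤ C * ‖x‖ :=
    (hf x).trans (mul_le_mul_of_nonneg_left (norm_posPart_le x) hC)
  refine ⟨f.mkContinuous C fun x => abs_le'.2 ⟨hf_norm x, ?_⟩,
    (monotone_iff_map_nonpos f).2 fun x hx => ?_, fun x => rfl⟩
  · simpa only [map_neg, norm_neg] using hf_norm (-x)
  · simpa only [posPart_eq_zero.2 hx, norm_zero, mul_zero] using hf x

theorem exists_monotone_sub_eq [IsOrderedModule ℝ E] (h : E →L[ℝ] ℝ) :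
    ∃ f g : E →L[ℝ] ℝ, Monotone f ∧ Monotone g ∧ ∀ x, f x - g x = h x := by
  have p_smul (c : ℝ) (hc : 0 < c) (x : E) : ‖h‖ * ‖(c • x)⁺‖ = c * (‖h‖ * ‖x⁺‖) := by
    rw [posPart_smul_of_nonneg hc.le, norm_smul, Real.norm_of_nonneg hc.le, mul_left_comm]
  have p_add (x y : E) : ‖h‖ * ‖(x + y)⁺‖ ≤ ‖h‖ * ‖x⁺‖ + ‖h‖ * ‖y⁺‖ := by
    rw [← mul_add]
    exact mul_le_mul_of_nonneg_left (norm_posPart_add_le x y) (norm_nonneg h)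
  have h_le (x : E) : h x ≤ ‖h‖ * ‖x⁺‖ + ‖h‖ * ‖(-x)⁺‖ := by
    rw [← mul_add]
    exact ((le_abs_self _).trans (h.le_opNorm x)).trans <|
      mul_le_mul_of_nonneg_left (norm_le_norm_posPart_add_norm_posPart_neg x) (norm_nonneg h)
  obtain ⟨F, G, hFG, hF, hG⟩ := exists_add_eq_of_le_add_sublinear p_smul p_add
    (fun c hc x => by rw [← smul_neg, p_smul c hc]) (fun x y => by rw [neg_add]; exact p_add _ _)
    h.toLinearMap h_le
  obtain ⟨f, hf, hfF⟩ := exists_monotone_continuousLinearMap_eq (norm_nonneg h) hF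
  obtain ⟨g, hg, hgG⟩ := exists_monotone_continuousLinearMap_eq (f := -G) (norm_nonneg h)
    fun x => by simpa using hG (-x)
  refine ⟨f, g, hf, hg, fun x => ?_⟩
  rw [hfF, hgG, LinearMap.neg_apply, sub_neg_eq_add]
  exact LinearMap.congr_fun hFG x

theorem exists_monotone_abs_apply_le [IsOrderedModule ℝ E] (h : E →L[ℝ] ℝ) :
    ∃ f : E →L[ℝ] ℝ, Monotone f ∧ ∀ x, |h x| ≤ f |x| := by
  obtain ⟨f, g, hf, hg, hfg⟩ := exists_monotone_sub_eq h
  refine ⟨f + g, hf.add hg, fun x => ?_⟩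
  calc |h x| = |f x - g x| := by rw [hfg]
    _ ≤ |f x| + |g x| := abs_sub (f x) (g x)
    _ ≤ f |x| + g |x| := add_le_add (abs_apply_le_apply_abs hf x) (abs_apply_le_apply_abs hg x)

end NormedLattice

section RelativelyWeaklyCompact

variable {E : Type*} [NormedAddCommGroup E] [NormedSpace ℝ E] [CompleteSpace E] [Lattice E]
  [IsOrderedAddMonoid E] [IsOrderedModule ℝ E] [HasSolidNorm E]

theorem exists_forall_pow_smul_le {a : ℕ → E} {M : ℝ}
    (ha : ∀ n, 0 ≤ a n) (haM : ∀ n, ‖a n‖ ≤ M) : ∃ z, ∀ n, (1 / 2 : ℝ) ^ n • a n ≤ z := by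
  have hsum : Summable fun n => (1 / 2 : ℝ) ^ n • a n :=
    .of_norm_bounded (summable_geometric_two.mul_right M) fun n => by
      rw [norm_smul, Real.norm_of_nonneg (by positivity)]
      exact mul_le_mul_of_nonneg_left (haM n) (by positivity)
  exact ⟨_, fun n => hsum.le_tsum n fun k _ => smul_nonneg (by positivity) (ha k)⟩

theorem IsRelativelyWeaklyCompact.tendsto_apply_zero_of_pairwise_inf_eq_zero {W : Set E}
    (hW : IsRelativelyWeaklyCompact W) {f : E →L[ℝ] ℝ} (hf : Monotone f) {v w : ℕ → E}
    (hw : ∀ k, w k ∈ W) (hv : ∀ k, 0 ≤ v k) (hvw : ∀ k, v k ≤ |w k|)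
    (hdisj : Pairwise fun i j => v i ⊓ v j = 0) : Tendsto (fun k => f (v k)) atTop (𝓝 0) := by
  let p (k : ℕ) : Seminorm ℝ E := bandSeminorm f.toLinearMap hf (v k) (hv k)
  have p_le (k : ℕ) (x : E) : p k x ≤ ‖f‖ * ‖x‖ :=
    calc p k x ≤ f |x| := bandSeminorm_le hf (hv k) x
      _ ≤ ‖f‖ * ‖|x|‖ := (le_abs_self _).trans (f.le_opNorm |x|)
      _ = ‖f‖ * ‖x‖ := by rw [norm_abs_eq_norm]
  choose g hgw hgp using fun k => exists_continuousLinearMap_apply_eq_seminorm (p k) (p_le k) (w k)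
  have hg (x : E) : Summable (g · x) :=
    .of_norm <| summable_of_sum_le (fun _ => norm_nonneg _) fun s =>
      (Finset.sum_le_sum fun k _ => hgp k x).trans (sum_bandSeminorm_le hf hv hdisj s x)
  have hgw_lim : Tendsto (fun k => g k (w k)) atTop (𝓝 0) := by
    rw [Metric.tendsto_nhds]
    intro ε hε
    filter_upwards [Metric.tendstoUniformlyOn_iff.1
      (hW.tendstoUniformlyOn_zero_of_summable hg) ε hε] with k hk
    rw [dist_comm]
    exact hk (w k) (hw k)
  refine squeeze_zero (fun k => (map_zero f).symm.trans_le (hf (hv k))) (fun k => ?_) hgw_lim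
  exact (apply_le_bandSeminorm hf (hv k) (hvw k)).trans_eq (hgw k).symm

theorem IsRelativelyWeaklyCompact.exists_forall_apply_posPart_abs_sub_le {W : Set E}
    (hW : IsRelativelyWeaklyCompact W) {f : E →L[ℝ] ℝ} (hf : Monotone f) {ε : ℝ} (hε : 0 < ε) :
    ∃ u, 0 ≤ u ∧ ∀ w ∈ W, f (|w| - u)⁺ ≤ ε := by
  by_contra! hcon
  obtain ⟨w, hw⟩ := exists_seq_forall_sum_range (fun x : E => |x|)
    (P := fun k s b => b ∈ W ∧ ε < f (|b| - (4 : ℝ) ^ k • |s|)⁺)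
    fun k s => hcon _ (smul_nonneg (by positivity) (abs_nonneg s))
  obtain ⟨M, hM⟩ := hW.exists_norm_le
  obtain ⟨z, hz⟩ := exists_forall_pow_smul_le (a := fun n => |w n|) (fun n => abs_nonneg (w n))
    fun n => (norm_abs_eq_norm (w n)).trans_le (hM _ (hw n).1)
  have z_nonneg : 0 ≤ z := (abs_nonneg (w 0)).trans (by simpa using hz 0)
  let v : ℕ → E := disjointification (fun n => |w n|) z
  have hv_lim : Tendsto (fun n => f (v n)) atTop (𝓝 0) :=
    hW.tendsto_apply_zero_of_pairwise_inf_eq_zero hf (fun n => (hw n).1)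
      (fun n => disjointification_nonneg n)
      (fun n => disjointification_le (fun n => abs_nonneg (w n)) z_nonneg n)
      (pairwise_disjointification_inf_eq_zero (fun n => abs_nonneg (w n)) z_nonneg hz)
  have hlim : Tendsto (fun n => f (v n) + (1 / 2 : ℝ) ^ n * f z) atTop (𝓝 0) := by
    simpa using hv_lim.add ((tendsto_pow_atTop_nhds_zero_of_lt_one (by norm_num)
      (by norm_num : (1 / 2 : ℝ) < 1)).mul_const (f z))
  refine hε.not_ge (ge_of_tendsto' hlim fun n => ?_)
  calc ε ≤ f (|w n| - (4 : ℝ) ^ n • ∑ i ∈ Finset.range n, |w i|)⁺ := by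
        simpa only [abs_of_nonneg (Finset.sum_nonneg fun i _ => abs_nonneg (w i))] using (hw n).2.le
    _ ≤ f (v n + (1 / 2 : ℝ) ^ n • z) :=
      hf (posPart_sub_smul_le_disjointification_add (a := fun n => |w n|) z_nonneg n)
    _ = f (v n) + (1 / 2 : ℝ) ^ n * f z := by rw [map_add, map_smul, smul_eq_mul]

theorem mainTheorem1_general {W : Set E} (hW : IsRelativelyWeaklyCompact W) {ι : Type*}
    {l : Filter ι} {x : ι → E} {a : E}
    (hxW : ∀ᶠ i in l, x i ∈ LatticeOrderedAddCommGroup.solidClosure W) (hx : UawTendsto x l a) :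
    WeakTendsto x l a := by
  refine weakTendsto_iff_forall_apply.2 fun h => Metric.tendsto_nhds.2 fun ε hε => ?_
  obtain ⟨f, hf, hhf⟩ := exists_monotone_abs_apply_le h
  obtain ⟨u, hu, hWu⟩ := hW.exists_forall_apply_posPart_abs_sub_le hf (half_pos hε)
  have hinf : Tendsto (fun i => f (|x i - a| ⊓ (u + |a|))) l (𝓝 0) := by
    simpa using weakTendsto_iff_forall_apply.1 (hx _ (add_nonneg hu (abs_nonneg a))) f
  filter_upwards [hxW, hinf.eventually_lt_const (half_pos hε)] with i ⟨w, hwW, hxw⟩ hi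
  calc |h (x i) - h a| = |h (x i - a)| := by rw [map_sub]
    _ ≤ f |x i - a| := hhf _
    _ = f (|x i - a| ⊓ (u + |a|)) + f (|x i - a| - (u + |a|))⁺ := by
      rw [← map_add, inf_add_posPart_sub]
    _ ≤ f (|x i - a| ⊓ (u + |a|)) + f (|w| - u)⁺ := by
      gcongr
      exact hf (posPart_mono (abs_sub_sub_le u hxw))
    _ < ε := by linarith [hWu w hwW]

end RelativelyWeaklyCompact

theorem mainTheorem1 {E : Type*} [NormedAddCommGroup E] [NormedSpace ℝ E] [CompleteSpace E]
    [Lattice E] [IsOrderedAddMonoid E] [IsOrderedModule ℝ E] [HasSolidNorm E]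
    (W : Set E) (hW : IsRelativelyWeaklyCompact W)
    (x : ℕ → E) (hxW : ∀ n, x n ∈ LatticeOrderedAddCommGroup.solidClosure W)
    (hx : UawTendsto x atTop 0) :
    WeakTendsto x atTop 0 :=
  mainTheorem1_general hW (.of_forall hxW) hx
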